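/- Let $r\ge 2$ be an integer. For each $n\ge 1$ consider an urn with $n$ balls of $n$ different colours, exactly one ball of each colour (the classical birthday case). Balls are drawn independently, uniformly and with replacement; let $Z_i(k)$ be the number of times colour $i$ occurs among the first $k$ draws, and let $$R_r=\inf\{k\ge 1:\ Z_i(k)\ge r \text{ for some } i\in\{1,\dots,n\}\}$$ be the time of the first $r$-fold repetition. Let $q_r(y)=\sum_{i=0}^{r-1}y^i/i!$, let $y(t)$ be the inverse function of $y\mapsto t=\bigl(r!\,(y-\log q_r(y))\bigr)^{1/r}$ on $[0,\infty)$, and for $t>0$ put $g_r(t)=\frac{t^{r-1}}{y(t)^{r-1}}\,q_r(y(t))$. Then, for all sufficiently small $t>0$, $g_r(t)=\sum_{i\ge 0}a_i(r)\,t^i$ with a convergent power series whose real coefficients $a_i(r)$ depend only on $r$; moreover $\mathbb E(R_r)<\infty$ for every $n$, and $\mathbb E(R_r)/n$ has, as $n\to\infty$, the asymptotic expansion in powers of $n^{-1/r}$ $$\frac{\mathbb E(R_r)}{n}\ \sim\ \frac1r\sum_{i=0}^{\infty}a_i(r)\,\Gamma\!\left(\tfrac{i+1}{r}\right)\left(\frac{r!}{n}\right)^{(i+1)/r},$$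 that is, for every integer $N\ge 0$, $$\frac{\mathbb E(R_r)}{n}=\frac1r\sum_{i=0}^{N-1}a_i(r)\,\Gamma\!\left(\tfrac{i+1}{r}\right)\left(\frac{r!}{n}\right)^{(i+1)/r}+O\!\left(n^{-(N+1)/r}\right)\qquad(n\to\infty).$$ -/

import Mathlib

open MeasureTheory ProbabilityTheory Filter Asymptotics

noncomputable section

namespace Birthday

/-- `x_i`, the number of balls of colour `i`, if the ball `b` has the colour `h b`. -/
def configuration {n m : ℕ} (h : Fin n → Fin m) (i : Fin m) : ℕ :=
  (Finset.univ.filter fun b => h b = i).card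

/-- `D 0, D 1, …` are the balls drawn, with replacement, from an urn of `n` distinguishable balls:
the draws are independent and each is uniform on the `n` balls. -/
structure IsDrawingWithReplacement {Ω : Type*} [MeasurableSpace Ω] (P : Measure Ω) {n : ℕ}
    (D : ℕ → Ω → Fin n) : Prop where
  measurable : ∀ j, Measurable (D j)
  indep : iIndepFun D P
  uniform : ∀ j b, P (D j ⁻¹' {b}) = (n : ENNReal)⁻¹

/-- `Z_i(k)`, the number of balls of colour `i` among the first `k` draws. -/
def occupancy {Ω : Type*} {n m : ℕ} (h : Fin n → Fin m) (D : ℕ → Ω → Fin n)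
    (i : Fin m) (k : ℕ) (ω : Ω) : ℕ :=
  ((Finset.range k).filter fun j => h (D j ω) = i).card

/-- `R_r`, the time of the first `r`-fold repetition of a colour; `⊤` if there is none. -/
def repetitionTime {Ω : Type*} {n m : ℕ} (h : Fin n → Fin m) (D : ℕ → Ω → Fin n)
    (r : ℕ) (ω : Ω) : ℕ∞ :=
  sInf ((fun k : ℕ => (k : ℕ∞)) '' {k : ℕ | 1 ≤ k ∧ ∃ i : Fin m, r ≤ occupancy h D i k ω})

/-- `E(R_r)`, as an extended nonnegative number. -/
def expectedRepetitionTime {Ω : Type*} [MeasurableSpace Ω] (P : Measure Ω) {n m : ℕ}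
    (h : Fin n → Fin m) (D : ℕ → Ω → Fin n) (r : ℕ) : ENNReal :=
  ∫⁻ ω, (repetitionTime h D r ω : ENNReal) ∂P

/-- `q_r(y) = ∑_{i < r} y^i / i!`. -/
def q (r : ℕ) (y : ℝ) : ℝ :=
  ∑ i ∈ Finset.range r, y ^ i / (i.factorial : ℝ)

/-- The substitution `t = (r! (y - log q_r(y)))^{1/r}`, for `y ≥ 0`. -/
def tOf (r : ℕ) (y : ℝ) : ℝ :=
  ((r.factorial : ℝ) * (y - Real.log (q r y))) ^ (1 / (r : ℝ))

/-- `y(t)`, the inverse of `y ↦ tOf r y` on `[0, ∞)`. -/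
def yOf (r : ℕ) (t : ℝ) : ℝ :=
  Function.invFunOn (tOf r) (Set.Ici 0) t

/-- `g_r(t) = (t / y(t))^{r-1} q_r(y(t))`, for `t > 0`. -/
def g (r : ℕ) (t : ℝ) : ℝ :=
  t ^ (r - 1) / yOf r t ^ (r - 1) * q r (yOf r t)

end Birthday

end

/-!
The event `R_r > k` says that no colour occurs `r` times in the first `k` draws, so its probability
is a sum of multinomial probabilities over count vectors with entries below `r`. Summing over `k`
and writing the factorials `(∑ i, c i)!` as Gamma integrals turns `E(R_r)` into
`n ∫₀^∞ ∏ i, q_r(m_i y) e^{-n y} dy`, where `m_i` is the number of balls of colour `i`. In the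
classical case the integrand is `e^{-n (y - log q_r(y))}`.

Since `d/dy (y - log q_r(y)) = y^{r-1} / ((r-1)! q_r(y))`, the phase `r! (y - log q_r(y))` is
increasing on `[0, ∞)` and vanishes at `0` to order exactly `r`. Hence it is the `r`-th power of an
analytic local coordinate `t`, whose inverse `y(t)` is analytic with `dy/dt = g_r(t)`. Away from `0`
the integral is exponentially small, and near `0` it is `∫ g_r(t) e^{-(n/r!) t^r} dt`, which
Watson's lemma expands term by term.
-/

namespace Birthday

open Set Topology
open scoped Finset

section Words

variable {ι α : Type*} [Fintype ι] [DecidableEq α]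

/-- The number of occurrences of the letter `a` in the word `f`, whose positions are indexed
by `ι`. -/
def letterCount (f : ι → α) (a : α) : ℕ :=
  #{j | f j = a}

theorem prod_comp_eq_prod_pow_letterCount [Fintype α] {R : Type*} [CommMonoid R] (p : α → R)
    (f : ι → α) : ∏ j, p (f j) = ∏ a, p a ^ letterCount f a := by
  simp only [letterCount, ← Finset.prod_const, Finset.prod_fiberwise']

theorem sum_letterCount [Fintype α] (f : ι → α) : ∑ a, letterCount f a = Fintype.card ι := by
  simp only [letterCount, Finset.card_eq_sum_ones, Finset.sum_fiberwise]
  simp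

/-- Both sides are the coefficient of `∏ a, X a ^ c a` in `(∑ a, X a) ^ card ι`. -/
theorem card_letterCount_eq [Fintype α] [DecidableEq ι] {c : α → ℕ}
    (hc : ∑ a, c a = Fintype.card ι) :
    #{f : ι → α | letterCount f = c} = Nat.multinomial Finset.univ c := by
  have monomial_eq (d : α → ℕ) : ∏ a, (MvPolynomial.X a : MvPolynomial α ℕ) ^ d a
      = MvPolynomial.monomial (Finsupp.equivFunOnFinite.symm d) 1 := by
    rw [MvPolynomial.monomial_eq, Finsupp.prod_fintype _ _ fun _ => pow_zero _]
    simp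
  have expansion_by_words : (∑ a, (MvPolynomial.X a : MvPolynomial α ℕ)) ^ Fintype.card ι
      = ∑ f : ι → α, ∏ a, MvPolynomial.X a ^ letterCount f a := by
    simp only [← prod_comp_eq_prod_pow_letterCount, ← Fintype.prod_sum, Finset.prod_const,
      Finset.card_univ]
  rw [Finset.sum_pow_eq_sum_piAntidiag] at expansion_by_words
  have coeff_eq := congrArg (MvPolynomial.coeff (Finsupp.equivFunOnFinite.symm c))
    expansion_by_words
  simp only [monomial_eq, MvPolynomial.coeff_sum, ← map_natCast MvPolynomial.C,
    MvPolynomial.coeff_C_mul, MvPolynomial.coeff_monomial, EmbeddingLike.apply_eq_iff_eq,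
    mul_ite, mul_one, mul_zero, Finset.sum_ite_eq', Finset.mem_piAntidiag] at coeff_eq
  rw [Finset.card_filter, ← coeff_eq]
  simp [hc]

theorem sum_prod_eq_sum_multinomial_mul_prod_pow [Fintype α] [DecidableEq ι] {R : Type*}
    [CommSemiring R] (p : α → R) (T : Finset (α → ℕ)) :
    ∑ f : ι → α with letterCount f ∈ T, ∏ j, p (f j)
      = ∑ c ∈ T with ∑ a, c a = Fintype.card ι,
          Nat.multinomial Finset.univ c * ∏ a, p a ^ c a := by
  rw [← Finset.sum_fiberwise_of_maps_to (g := letterCount)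
    (t := {c ∈ T | ∑ a, c a = Fintype.card ι})]
  · refine Finset.sum_congr rfl fun c hc => ?_
    obtain ⟨hcT, hsum⟩ := Finset.mem_filter.1 hc
    have fiber_eq : ({f : ι → α | letterCount f ∈ T} : Finset (ι → α)).filter
        (letterCount · = c) = ({f | letterCount f = c} : Finset (ι → α)) := by
      ext f
      simpa using fun hf : letterCount f = c => hf ▸ hcT
    rw [fiber_eq, ← card_letterCount_eq hsum, ← nsmul_eq_mul, ← Finset.sum_const]
    refine Finset.sum_congr rfl fun f hf => ?_
    rw [prod_comp_eq_prod_pow_letterCount, (Finset.mem_filter.1 hf).2]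
  · intro f hf
    exact Finset.mem_filter.2 ⟨(Finset.mem_filter.1 hf).2, sum_letterCount f⟩

end Words

section RepetitionTime

variable {Ω : Type*} {n m : ℕ} (h : Fin n → Fin m) (D : ℕ → Ω → Fin n)

/-- The colours of the first `k` draws, as a word over the set of colours. -/
def colourWord (k : ℕ) (ω : Ω) : Fin k → Fin m :=
  fun j => h (D j ω)

theorem occupancy_eq_letterCount (i : Fin m) (k : ℕ) (ω : Ω) :
    occupancy h D i k ω = letterCount (colourWord h D k ω) i := by
  rw [occupancy, letterCount, Finset.card_filter, Finset.card_filter]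
  exact (Fin.sum_univ_eq_sum_range (fun j => if h (D j ω) = i then 1 else 0) k).symm

theorem setOf_occupancy_lt_eq (r k : ℕ) :
    {ω | ∀ i, occupancy h D i k ω < r} = colourWord h D k ⁻¹'
      ({f | letterCount f ∈ Fintype.piFinset fun _ => Finset.range r} :
        Finset (Fin k → Fin m)) := by
  ext ω
  simp [occupancy_eq_letterCount]

theorem occupancy_mono (i : Fin m) (ω : Ω) : Monotone fun k => occupancy h D i k ω :=
  fun _ _ hkl => Finset.card_le_card (Finset.filter_subset_filter _ (Finset.range_mono hkl))

theorem lt_repetitionTime_iff {r : ℕ} (hr : 0 < r) (k : ℕ) (ω : Ω) :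
    (k : ℕ∞) < repetitionTime h D r ω ↔ ∀ i, occupancy h D i k ω < r := by
  rw [← ENat.add_one_le_iff (ENat.natCast_ne_top k), repetitionTime, le_sInf_iff, forall_mem_image]
  norm_cast
  constructor
  · intro hlt i
    by_contra! hi
    have hk : 1 ≤ k := by
      rcases Nat.eq_zero_or_pos k with rfl | hk
      · simp only [occupancy, Finset.range_zero, Finset.filter_empty, Finset.card_empty] at hi
        omega
      · exact hk
    exact absurd (hlt ⟨hk, i, hi⟩) (Nat.not_succ_le_self k)
  · rintro hlt l ⟨-, i, hi⟩
    by_contra! hlk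
    exact (hlt i).not_ge (hi.trans (occupancy_mono h D i ω (Nat.lt_succ_iff.1 hlk)))

theorem toENNReal_eq_tsum_indicator_lt (N : ℕ∞) :
    (N : ENNReal) = ∑' k : ℕ, {k : ℕ | (k : ℕ∞) < N}.indicator 1 k := by
  cases N with
  | top => simp [ENNReal.tsum_one]
  | coe N =>
    have indicator_eq (k : ℕ) (hk : k ∈ Finset.range N) :
        {k : ℕ | (k : ℕ∞) < N}.indicator (1 : ℕ → ENNReal) k = 1 :=
      indicator_of_mem (by simpa using hk) _
    rw [tsum_eq_sum (s := Finset.range N) fun k hk => by simpa using hk,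
      Finset.sum_congr rfl indicator_eq]
    simp

end RepetitionTime

section Drawing

variable {Ω : Type*} [MeasurableSpace Ω] {P : Measure Ω} {n m : ℕ} {D : ℕ → Ω → Fin n}

namespace IsDrawingWithReplacement

theorem pos (hD : IsDrawingWithReplacement P D) : 0 < n := by
  have := hD.indep.isProbabilityMeasure
  obtain ⟨ω⟩ := P.nonempty_of_neZero
  exact (D 0 ω).pos

theorem measurable_colourWord (hD : IsDrawingWithReplacement P D) (h : Fin n → Fin m) (k : ℕ) :
    Measurable (colourWord h D k) :=
  measurable_pi_lambda _ fun j => (measurable_of_finite h).comp (hD.measurable j)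

theorem measure_colour_eq (hD : IsDrawingWithReplacement P D) (h : Fin n → Fin m) (j : ℕ)
    (i : Fin m) : P ((h ∘ D j) ⁻¹' {i}) = configuration h i / n := by
  have preimage_eq : h ⁻¹' {i} = ({b | h b = i} : Finset (Fin n)) := by
    ext b
    simp
  rw [preimage_comp, preimage_eq, ← sum_measure_preimage_singleton _
    fun b _ => hD.measurable j (measurableSet_singleton b)]
  simp only [hD.uniform, Finset.sum_const, nsmul_eq_mul, configuration, div_eq_mul_inv]

theorem measure_colourWord_eq (hD : IsDrawingWithReplacement P D) (h : Fin n → Fin m) {k : ℕ}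
    (f : Fin k → Fin m) :
    P (colourWord h D k ⁻¹' {f}) = ∏ j, (configuration h (f j) / n : ENNReal) := by
  have indep_colours : iIndepFun (fun j : Fin k => h ∘ D j) P :=
    (hD.indep.precomp Fin.val_injective).comp _ fun _ => measurable_of_finite h
  have preimage_eq : colourWord h D k ⁻¹' {f}
      = ⋂ j ∈ Finset.univ, (h ∘ D (j : Fin k)) ⁻¹' {f j} := by
    ext ω
    simp [colourWord, funext_iff]
  rw [preimage_eq, indep_colours.measure_inter_preimage_eq_mul Finset.univ
    fun j _ => measurableSet_singleton _]
  simp only [hD.measure_colour_eq]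

theorem measure_occupancy_lt_eq (hD : IsDrawingWithReplacement P D) (h : Fin n → Fin m)
    (r k : ℕ) :
    P {ω | ∀ i, occupancy h D i k ω < r}
      = ∑ c ∈ Fintype.piFinset fun _ => Finset.range r with ∑ i, c i = k,
          Nat.multinomial Finset.univ c * ∏ i, (configuration h i / n : ENNReal) ^ c i := by
  have sum_words := sum_prod_eq_sum_multinomial_mul_prod_pow (ι := Fin k)
    (fun i => (configuration h i / n : ENNReal)) (Fintype.piFinset fun _ => Finset.range r)
  rw [Fintype.card_fin] at sum_words
  rw [setOf_occupancy_lt_eq, ← sum_words, ← sum_measure_preimage_singleton _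
    fun f _ => hD.measurable_colourWord h k (measurableSet_singleton f)]
  simp only [hD.measure_colourWord_eq]

theorem expectedRepetitionTime_eq_sum (hD : IsDrawingWithReplacement P D) (h : Fin n → Fin m)
    {r : ℕ} (hr : 0 < r) :
    expectedRepetitionTime P h D r
      = ∑ c ∈ Fintype.piFinset fun _ => Finset.range r,
          Nat.multinomial Finset.univ c * ∏ i, (configuration h i / n : ENNReal) ^ c i := by
  have measurableSet_lt (k : ℕ) : MeasurableSet {ω | ∀ i, occupancy h D i k ω < r} := by
    rw [setOf_occupancy_lt_eq]
    exact hD.measurable_colourWord h k (Finset.measurableSet _)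
  have repetitionTime_eq (ω : Ω) : (repetitionTime h D r ω : ENNReal)
      = ∑' k, {ω | ∀ i, occupancy h D i k ω < r}.indicator 1 ω := by
    simp only [toENNReal_eq_tsum_indicator_lt, indicator_apply, mem_ofPred_eq,
      lt_repetitionTime_iff h D hr, Pi.one_apply]
  simp only [expectedRepetitionTime, repetitionTime_eq]
  rw [lintegral_tsum fun k => (measurable_one.indicator (measurableSet_lt k)).aemeasurable]
  simp only [lintegral_indicator_one (measurableSet_lt _), hD.measure_occupancy_lt_eq,
    Finset.sum_filter]
  rw [Summable.tsum_finsetSum fun _ _ => ENNReal.summable]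
  simp only [tsum_ite_eq']

end IsDrawingWithReplacement

end Drawing

section LaplaceRepresentation

theorem integrableOn_pow_mul_exp_neg_mul_pow (k : ℕ) {r : ℕ} (hr : 0 < r) {x : ℝ} (hx : 0 < x) :
    IntegrableOn (fun t : ℝ => t ^ k * Real.exp (-(x * t ^ r))) (Ioi 0) := by
  have hk : (-1 : ℝ) < k := by linarith [k.cast_nonneg (α := ℝ)]
  simpa only [Real.rpow_natCast, neg_mul] using
    integrableOn_rpow_mul_exp_neg_mul_rpow hk (Nat.cast_pos.2 hr) hx

theorem integral_pow_mul_exp_neg_mul_pow (k : ℕ) {r : ℕ} (hr : 0 < r) {x : ℝ} (hx : 0 < x) :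
    ∫ t in Ioi (0 : ℝ), t ^ k * Real.exp (-(x * t ^ r))
      = 1 / r * (Real.Gamma ((k + 1) / r) * x ^ (-((k + 1) / r : ℝ))) := by
  have hk : (-1 : ℝ) < k := by linarith [k.cast_nonneg (α := ℝ)]
  have gamma_integral := integral_rpow_mul_exp_neg_mul_rpow (Nat.cast_pos.2 hr) hk hx
  simp only [Real.rpow_natCast, neg_mul] at gamma_integral
  rw [gamma_integral, neg_div]
  ring

theorem integrableOn_pow_mul_exp_neg_mul (k : ℕ) {b : ℝ} (hb : 0 < b) :
    IntegrableOn (fun y : ℝ => y ^ k * Real.exp (-(b * y))) (Ioi 0) := by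
  simpa only [pow_one] using integrableOn_pow_mul_exp_neg_mul_pow k one_pos hb

theorem integral_pow_mul_exp_neg_mul (k : ℕ) {b : ℝ} (hb : 0 < b) :
    ∫ y in Ioi (0 : ℝ), y ^ k * Real.exp (-(b * y)) = k.factorial / b ^ (k + 1) := by
  have gamma_integral := integral_pow_mul_exp_neg_mul_pow k one_pos hb
  simp only [pow_one, Nat.cast_one, div_one, one_mul, Real.Gamma_nat_eq_factorial]
    at gamma_integral
  rw [gamma_integral, ← Nat.cast_add_one, Real.rpow_neg hb.le, Real.rpow_natCast, div_eq_mul_inv]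

variable {ι : Type*} [Fintype ι] (r : ℕ) (x : ι → ℝ)

theorem prod_q_mul_eq_sum [DecidableEq ι] (y : ℝ) :
    ∏ i, q r (x i * y) = ∑ c ∈ Fintype.piFinset fun _ => Finset.range r,
      (∏ i, x i ^ c i / (c i).factorial) * y ^ ∑ i, c i := by
  simp only [q, Finset.prod_univ_sum]
  refine Finset.sum_congr rfl fun c _ => ?_
  rw [← Finset.prod_pow_eq_pow_sum, ← Finset.prod_mul_distrib]
  exact Finset.prod_congr rfl fun i _ => by rw [mul_pow, mul_div_right_comm]

theorem integrableOn_prod_q_mul_exp_neg_mul {b : ℝ} (hb : 0 < b) :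
    IntegrableOn (fun y => (∏ i, q r (x i * y)) * Real.exp (-(b * y))) (Ioi 0) := by
  classical
  simp only [prod_q_mul_eq_sum, Finset.sum_mul, mul_assoc]
  exact integrable_finsetSum _ fun c _ => (integrableOn_pow_mul_exp_neg_mul _ hb).const_mul _

theorem mul_integral_prod_q_mul_exp_neg_mul [DecidableEq ι] {b : ℝ} (hb : 0 < b) :
    b * ∫ y in Ioi (0 : ℝ), (∏ i, q r (x i * y)) * Real.exp (-(b * y))
      = ∑ c ∈ Fintype.piFinset fun _ => Finset.range r,
          Nat.multinomial Finset.univ c * ∏ i, (x i / b) ^ c i := by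
  simp only [prod_q_mul_eq_sum, Finset.sum_mul, mul_assoc]
  rw [integral_finsetSum _ fun c _ => (integrableOn_pow_mul_exp_neg_mul _ hb).const_mul _,
    Finset.mul_sum]
  refine Finset.sum_congr rfl fun c _ => ?_
  have multinomial_eq : (Nat.multinomial Finset.univ c : ℝ)
      = (∑ i, c i).factorial / ∏ i, ((c i).factorial : ℝ) := by
    rw [eq_div_iff (by positivity), mul_comm]
    exact_mod_cast Nat.multinomial_spec Finset.univ c
  simp only [integral_const_mul, integral_pow_mul_exp_neg_mul _ hb, multinomial_eq, div_pow,
    Finset.prod_div_distrib, Finset.prod_pow_eq_pow_sum]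
  field_simp
  ring

end LaplaceRepresentation

section Drawing

variable {Ω : Type*} [MeasurableSpace Ω] {P : Measure Ω} {n m : ℕ} {D : ℕ → Ω → Fin n}

theorem IsDrawingWithReplacement.expectedRepetitionTime_eq_integral
    (hD : IsDrawingWithReplacement P D) (h : Fin n → Fin m) {r : ℕ} (hr : 0 < r) :
    expectedRepetitionTime P h D r = ENNReal.ofReal
      (n * ∫ y in Ioi (0 : ℝ), (∏ i, q r (configuration h i * y)) * Real.exp (-(n * y))) := by
  have hn : (0 : ℝ) < n := Nat.cast_pos.2 hD.pos
  rw [hD.expectedRepetitionTime_eq_sum h hr,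
    mul_integral_prod_q_mul_exp_neg_mul r (fun i => (configuration h i : ℝ)) hn,
    ENNReal.ofReal_sum_of_nonneg fun c _ => by positivity]
  refine Finset.sum_congr rfl fun c _ => ?_
  rw [ENNReal.ofReal_mul (by positivity), ENNReal.ofReal_prod_of_nonneg fun i _ => by positivity]
  simp [ENNReal.ofReal_pow, ENNReal.ofReal_div_of_pos hn, div_nonneg]

end Drawing

section AnalyticRoot

theorem exists_analyticAt_eventually_eq_mul_pow {f : ℝ → ℝ} {r : ℕ} (hr : r ≠ 0)
    (hf : AnalyticAt ℝ f 0) (hord : analyticOrderAt f 0 = r) (hpos : ∀ᶠ y in 𝓝[>] 0, 0 < f y) :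
    ∃ E : ℝ → ℝ, AnalyticAt ℝ E 0 ∧ 0 < E 0 ∧ ∀ᶠ y in 𝓝 0, f y = (y * E y) ^ r := by
  obtain ⟨ψ, hψ, hψ0, f_eq⟩ := hf.analyticOrderAt_eq_natCast.1 hord
  simp only [sub_zero, smul_eq_mul] at f_eq
  have ψ_nonneg : 0 ≤ ψ 0 := by
    have ψ_tendsto : Tendsto ψ (𝓝[>] 0) (𝓝 (ψ 0)) :=
      hψ.continuousAt.tendsto.mono_left nhdsWithin_le_nhds
    refine ge_of_tendsto ψ_tendsto ?_
    filter_upwards [hpos, f_eq.filter_mono nhdsWithin_le_nhds, self_mem_nhdsWithin]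
      with y hy f_eq_y (y_pos : 0 < y)
    rw [f_eq_y] at hy
    exact (pos_of_mul_pos_right hy (by positivity)).le
  have ψ_pos : 0 < ψ 0 := ψ_nonneg.lt_of_ne' hψ0
  refine ⟨fun y => Real.exp (Real.log (ψ y) / r), ?_, Real.exp_pos _, ?_⟩
  · exact ((hψ.log ψ_pos).div analyticAt_const (by positivity)).rexp
  · filter_upwards [f_eq, hψ.continuousAt.tendsto.eventually_const_lt ψ_pos] with y f_eq_y ψy_pos
    rw [f_eq_y, mul_pow, ← Real.exp_nat_mul, mul_div_cancel₀ _ (by positivity),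
      Real.exp_log ψy_pos]

theorem exists_analyticAt_comp_eq_pow {f : ℝ → ℝ} {r : ℕ} (hr : r ≠ 0)
    (hf : AnalyticAt ℝ f 0) (hord : analyticOrderAt f 0 = r) (hpos : ∀ᶠ y in 𝓝[>] 0, 0 < f y) :
    ∃ Y : ℝ → ℝ, AnalyticAt ℝ Y 0 ∧ Y 0 = 0 ∧ (∀ᶠ t in 𝓝[>] 0, 0 < Y t) ∧
      ∀ᶠ t in 𝓝 0, f (Y t) = t ^ r := by
  obtain ⟨E, hE, E_pos, f_eq⟩ := exists_analyticAt_eventually_eq_mul_pow hr hf hord hpos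
  set τ : ℝ → ℝ := fun y => y * E y
  have hτ : AnalyticAt ℝ τ 0 := analyticAt_id.mul hE
  have τ_zero : τ 0 = 0 := zero_mul _
  have deriv_τ : deriv τ 0 = E 0 := by
    simpa using ((hasDerivAt_id' (0 : ℝ)).fun_mul hE.differentiableAt.hasDerivAt).deriv
  have deriv_τ_ne : deriv τ 0 ≠ 0 := deriv_τ ▸ E_pos.ne'
  set Y := hτ.hasStrictDerivAt.localInverse _ _ _ deriv_τ_ne
  have hY : AnalyticAt ℝ Y 0 := τ_zero ▸ hτ.analyticAt_localInverse deriv_τ_ne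
  have τ_Y : ∀ᶠ t in 𝓝 0, τ (Y t) = t := by
    simpa only [τ_zero] using hτ.hasStrictDerivAt.eventually_right_inverse deriv_τ_ne
  have Y_zero : Y 0 = 0 := by
    simpa only [τ_zero] using
      (hτ.hasStrictDerivAt.eventually_left_inverse deriv_τ_ne).self_of_nhds
  have Y_tendsto : Tendsto Y (𝓝 0) (𝓝 0) := by simpa only [Y_zero] using hY.continuousAt.tendsto
  refine ⟨Y, hY, Y_zero, ?_, ?_⟩
  · filter_upwards [τ_Y.filter_mono nhdsWithin_le_nhds, self_mem_nhdsWithin,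
      (Y_tendsto.eventually (hE.continuousAt.tendsto.eventually_const_lt E_pos)).filter_mono
        nhdsWithin_le_nhds] with t τ_Y_t (t_pos : 0 < t) E_pos_t
    exact pos_of_mul_pos_left (b := E (Y t)) (t_pos.trans_eq τ_Y_t.symm) E_pos_t.le
  · filter_upwards [τ_Y, Y_tendsto.eventually f_eq] with t τ_Y_t f_eq_t
    rw [f_eq_t, show Y t * E (Y t) = t from τ_Y_t]

end AnalyticRoot

section Phase

/-- The phase `r! (y - log q_r(y))` of the Laplace integral for `E(R_r)`. It is `t ^ r` in the
variable `t` of `tOf`. -/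
noncomputable def phase (r : ℕ) (y : ℝ) : ℝ :=
  r.factorial * (y - Real.log (q r y))

theorem q_succ (s : ℕ) (y : ℝ) : q (s + 1) y = q s y + y ^ s / s.factorial :=
  Finset.sum_range_succ _ _

theorem hasDerivAt_q_succ (s : ℕ) (y : ℝ) : HasDerivAt (q (s + 1)) (q s y) y := by
  induction s with
  | zero =>
    have q_one_eq : q (0 + 1) = fun _ => 1 := by
      funext y
      simp [q]
    simpa only [q_one_eq, q, Finset.sum_range_zero] using hasDerivAt_const y (1 : ℝ)
  | succ s ih =>
    have hasDerivAt_last : HasDerivAt (fun y : ℝ => y ^ (s + 1) / (s + 1).factorial)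
        (y ^ s / s.factorial) y := by
      convert! (hasDerivAt_pow (s + 1) y).div_const ((s + 1).factorial : ℝ) using 1
      rw [Nat.factorial_succ]
      push_cast
      field_simp
    rw [q_succ s, funext (q_succ (s + 1))]
    exact ih.add hasDerivAt_last

theorem analyticAt_q (r : ℕ) (y : ℝ) : AnalyticAt ℝ (q r) y := by
  unfold q
  fun_prop

variable {r : ℕ} {y : ℝ}

theorem hasDerivAt_phase (hy : q r y ≠ 0) :
    HasDerivAt (phase r) (r * y ^ (r - 1) / q r y) y := by
  cases r with
  | zero => exact absurd (by simp [q]) hy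
  | succ s =>
    convert! ((hasDerivAt_id y).sub ((hasDerivAt_q_succ s y).log hy)).const_mul
      ((s + 1).factorial : ℝ) using 1
    rw [eq_sub_of_add_eq (q_succ s y).symm, Nat.factorial_succ, Nat.add_sub_cancel]
    push_cast
    field_simp
    ring

theorem q_zero_right (hr : 0 < r) : q r 0 = 1 := by
  obtain ⟨s, rfl⟩ := Nat.exists_eq_add_one.2 hr
  simp [q, Finset.sum_range_succ']

theorem q_pos (hr : 0 < r) (hy : 0 ≤ y) : 0 < q r y :=
  Finset.sum_pos' (fun _ _ => by positivity) ⟨0, Finset.mem_range.2 hr, by simp⟩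

theorem phase_zero_right (hr : 0 < r) : phase r 0 = 0 := by
  simp [phase, q_zero_right hr]

theorem continuousOn_phase (hr : 0 < r) : ContinuousOn (phase r) (Ici 0) := fun _ hy =>
  (hasDerivAt_phase (q_pos hr hy).ne').continuousAt.continuousWithinAt

theorem strictMonoOn_phase (hr : 0 < r) : StrictMonoOn (phase r) (Ici 0) := by
  refine strictMonoOn_of_deriv_pos (convex_Ici 0) (continuousOn_phase hr) fun y hy => ?_
  rw [interior_Ici, mem_Ioi] at hy
  have q_pos_y := q_pos hr hy.le
  rw [(hasDerivAt_phase q_pos_y.ne').deriv]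
  positivity

theorem phase_nonneg (hr : 0 < r) (hy : 0 ≤ y) : 0 ≤ phase r y :=
  phase_zero_right hr ▸ (strictMonoOn_phase hr).monotoneOn self_mem_Ici hy hy

theorem phase_pos (hr : 0 < r) (hy : 0 < y) : 0 < phase r y :=
  phase_zero_right hr ▸ strictMonoOn_phase hr self_mem_Ici hy.le hy

theorem analyticAt_phase (hr : 0 < r) : AnalyticAt ℝ (phase r) 0 :=
  analyticAt_const.mul (analyticAt_id.sub ((analyticAt_q r 0).log (q_pos hr le_rfl)))

theorem analyticOrderAt_phase (hr : 0 < r) : analyticOrderAt (phase r) 0 = r := by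
  have deriv_eq : ∀ᶠ y in 𝓝 0, deriv (phase r) y = (y - 0) ^ (r - 1) • (r / q r y) := by
    filter_upwards [(analyticAt_q r 0).continuousAt.tendsto.eventually_const_lt (q_pos hr le_rfl)]
      with y hy
    rw [(hasDerivAt_phase hy.ne').deriv, sub_zero, smul_eq_mul]
    ring
  have order_deriv : analyticOrderAt (deriv (phase r)) 0 = (r - 1 : ℕ) :=
    (analyticAt_phase hr).deriv.analyticOrderAt_eq_natCast.2
      ⟨_, analyticAt_const.div (analyticAt_q r 0) (q_pos hr le_rfl).ne',
        by simp [q_zero_right hr, hr.ne'], deriv_eq⟩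
  have order_succ := (analyticAt_phase hr).analyticOrderAt_deriv_add_one
  simp only [phase_zero_right hr, sub_zero, order_deriv] at order_succ
  rw [← order_succ]
  exact_mod_cast Nat.sub_add_cancel hr

theorem exp_neg_div_factorial_mul_phase (hr : 0 < r) (n : ℕ) (hy : 0 ≤ y) :
    Real.exp (-(n / r.factorial * phase r y)) = q r y ^ n * Real.exp (-(n * y)) := by
  have exponent_eq : -(n / r.factorial * phase r y) = n * Real.log (q r y) + -(n * y) := by
    rw [phase]
    field_simp
    ring
  rw [exponent_eq, Real.exp_add, Real.exp_nat_mul, Real.exp_log (q_pos hr hy)]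

theorem integrableOn_exp_neg_phase (hr : 0 < r) :
    IntegrableOn (fun y => Real.exp (-phase r y)) (Ioi 0) := by
  have factorial_pos : (0 : ℝ) < r.factorial := by positivity
  refine (integrableOn_prod_q_mul_exp_neg_mul r (fun _ : Fin r.factorial => 1)
    factorial_pos).congr_fun (fun y hy => ?_) measurableSet_Ioi
  have exp_eq := exp_neg_div_factorial_mul_phase hr r.factorial (le_of_lt hy)
  rw [div_self factorial_pos.ne', one_mul] at exp_eq
  simp [exp_eq]

theorem tOf_eq_of_phase_eq_pow (hr : 0 < r) {t : ℝ} (ht : 0 ≤ t) (h : phase r y = t ^ r) :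
    tOf r y = t := by
  rw [tOf, ← phase, h, one_div, Real.pow_rpow_inv_natCast ht hr.ne']

theorem injOn_tOf (hr : 0 < r) : InjOn (tOf r) (Ici 0) := fun _ hx _ hy hxy =>
  (strictMonoOn_phase hr).injOn hx hy <|
    (Real.rpow_left_inj (phase_nonneg hr hx) (phase_nonneg hr hy) (by positivity)).1 hxy

theorem yOf_tOf (hr : 0 < r) (hy : 0 ≤ y) : yOf r (tOf r y) = y :=
  (injOn_tOf hr).leftInvOn_invFunOn hy

/-- Since `phase r (Y t) = t ^ r`, the chain rule identifies the derivative of `Y` with `g r`. -/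
theorem exists_analyticAt_inverse (hr : 0 < r) :
    ∃ Y : ℝ → ℝ, AnalyticAt ℝ Y 0 ∧ Y 0 = 0 ∧
      ∀ᶠ t in 𝓝[>] 0, 0 < Y t ∧ phase r (Y t) = t ^ r ∧ deriv Y t = g r t := by
  obtain ⟨Y, hY, Y_zero, Y_pos, phase_Y⟩ := exists_analyticAt_comp_eq_pow hr.ne'
    (analyticAt_phase hr) (analyticOrderAt_phase hr)
    (eventually_nhdsWithin_of_forall fun _ => phase_pos hr)
  refine ⟨Y, hY, Y_zero, ?_⟩
  filter_upwards [Y_pos, phase_Y.eventually_nhds.filter_mono nhdsWithin_le_nhds,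
    hY.eventually_analyticAt.filter_mono nhdsWithin_le_nhds, self_mem_nhdsWithin]
    with t Y_pos_t phase_Y_near hY_t (t_pos : 0 < t)
  have phase_Y_t : phase r (Y t) = t ^ r := phase_Y_near.self_of_nhds
  refine ⟨Y_pos_t, phase_Y_t, ?_⟩
  have yOf_eq : yOf r t = Y t := by
    rw [← tOf_eq_of_phase_eq_pow hr t_pos.le phase_Y_t, yOf_tOf hr Y_pos_t.le,
      tOf_eq_of_phase_eq_pow hr t_pos.le phase_Y_t]
  have q_pos_Y := q_pos hr Y_pos_t.le
  have chain_rule : r * t ^ (r - 1) = r * Y t ^ (r - 1) / q r (Y t) * deriv Y t :=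
    ((hasDerivAt_pow r t).congr_of_eventuallyEq phase_Y_near).unique
      ((hasDerivAt_phase q_pos_Y.ne').comp t hY_t.differentiableAt.hasDerivAt)
  rw [g, yOf_eq]
  have Y_pow_ne : Y t ^ (r - 1) ≠ 0 := by positivity
  field_simp at chain_rule ⊢
  linarith

end Phase

section ExponentialTail

variable {α : Type*} [MeasurableSpace α] {μ : Measure α} {θ : α → ℝ}

theorem integrable_exp_neg_mul (hθ : ∀ᵐ y ∂μ, 0 ≤ θ y)
    (hint : Integrable (fun y => Real.exp (-θ y)) μ) {x : ℝ} (hx : 1 ≤ x) :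
    Integrable (fun y => Real.exp (-(x * θ y))) μ := by
  have exp_eq_rpow (y : α) : Real.exp (-(x * θ y)) = Real.exp (-θ y) ^ x := by
    rw [← Real.exp_mul]
    ring_nf
  refine hint.mono' ?_ (hθ.mono fun y hy => ?_)
  · simp only [exp_eq_rpow]
    exact (hint.aemeasurable.pow_const x).aestronglyMeasurable
  · rw [Real.norm_eq_abs, Real.abs_exp]
    exact Real.exp_le_exp.2 (neg_le_neg (le_mul_of_one_le_left hy hx))

theorem isBigO_integral_exp_neg_mul {c : ℝ} (hc : 0 < c) (hθ : ∀ᵐ y ∂μ, c ≤ θ y)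
    (hint : Integrable (fun y => Real.exp (-θ y)) μ) (b : ℝ) :
    (fun x : ℝ => ∫ y, Real.exp (-(x * θ y)) ∂μ) =O[atTop] fun x => x ^ b := by
  have bound : (fun x : ℝ => ∫ y, Real.exp (-(x * θ y)) ∂μ)
      =O[atTop] fun x => Real.exp (-c * x) := by
    refine .of_bound (Real.exp c * ∫ y, Real.exp (-θ y) ∂μ) ?_
    filter_upwards [eventually_ge_atTop 1] with x hx
    calc ‖∫ y, Real.exp (-(x * θ y)) ∂μ‖
        ≤ ∫ y, Real.exp c * Real.exp (-c * x) * Real.exp (-θ y) ∂μ := by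
          refine norm_integral_le_of_norm_le (hint.const_mul _) (hθ.mono fun y hy => ?_)
          rw [Real.norm_eq_abs, Real.abs_exp, ← Real.exp_add, ← Real.exp_add, Real.exp_le_exp]
          nlinarith
      _ = Real.exp c * (∫ y, Real.exp (-θ y) ∂μ) * ‖Real.exp (-c * x)‖ := by
          rw [integral_const_mul, Real.norm_eq_abs, Real.abs_exp]
          ring
  exact bound.trans (isLittleO_exp_neg_mul_rpow_atTop hc b).isBigO

end ExponentialTail

section Watson

theorem integrableOn_sum_mul_exp_neg_mul_pow {r : ℕ} (hr : 0 < r) (a : ℕ → ℝ) (N : ℕ) {x : ℝ}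
    (hx : 0 < x) :
    IntegrableOn (fun t => (∑ i ∈ Finset.range N, a i * t ^ i) * Real.exp (-(x * t ^ r)))
      (Ioi 0) := by
  simp only [Finset.sum_mul, mul_assoc]
  exact integrable_finsetSum _ fun i _ =>
    (integrableOn_pow_mul_exp_neg_mul_pow i hr hx).const_mul (a i)

theorem integral_sum_mul_exp_neg_mul_pow {r : ℕ} (hr : 0 < r) (a : ℕ → ℝ) (N : ℕ) {x : ℝ}
    (hx : 0 < x) :
    ∫ t in Ioi 0, (∑ i ∈ Finset.range N, a i * t ^ i) * Real.exp (-(x * t ^ r))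
      = 1 / r * ∑ i ∈ Finset.range N,
          a i * Real.Gamma ((i + 1) / r) * x ^ (-((i + 1) / r : ℝ)) := by
  simp only [Finset.sum_mul, mul_assoc]
  rw [integral_finsetSum _ fun i _ =>
    (integrableOn_pow_mul_exp_neg_mul_pow i hr hx).const_mul (a i), Finset.mul_sum]
  refine Finset.sum_congr rfl fun i _ => ?_
  rw [integral_const_mul, integral_pow_mul_exp_neg_mul_pow i hr hx, mul_left_comm]

variable {F : ℝ → ℝ} {a : ℕ → ℝ} {N : ℕ} {C : ℝ}

theorem abs_integral_mul_exp_neg_mul_pow_sub_le {r : ℕ} (hr : 0 < r)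
    (hF : AEStronglyMeasurable F (volume.restrict (Ioi 0)))
    (hFa : ∀ t > 0, |F t - ∑ i ∈ Finset.range N, a i * t ^ i| ≤ C * t ^ N) {x : ℝ} (hx : 0 < x) :
    |(∫ t in Ioi 0, F t * Real.exp (-(x * t ^ r)))
        - 1 / r * ∑ i ∈ Finset.range N,
            a i * Real.Gamma ((i + 1) / r) * x ^ (-((i + 1) / r : ℝ))|
      ≤ C * (1 / r * (Real.Gamma ((N + 1) / r) * x ^ (-((N + 1) / r : ℝ)))) := by
  set S : ℝ → ℝ := fun t => ∑ i ∈ Finset.range N, a i * t ^ i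
  set w : ℝ → ℝ := fun t => Real.exp (-(x * t ^ r))
  have integrable_S : IntegrableOn (fun t => S t * w t) (Ioi 0) :=
    integrableOn_sum_mul_exp_neg_mul_pow hr a N hx
  have integrable_bound : IntegrableOn (fun t => C * (t ^ N * w t)) (Ioi 0) :=
    (integrableOn_pow_mul_exp_neg_mul_pow N hr hx).const_mul C
  have error_le : ∀ᵐ t ∂volume.restrict (Ioi 0), ‖(F t - S t) * w t‖ ≤ C * (t ^ N * w t) := by
    filter_upwards [ae_restrict_mem measurableSet_Ioi] with t ht
    rw [norm_mul, Real.norm_eq_abs, Real.norm_eq_abs, Real.abs_exp, ← mul_assoc]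
    exact mul_le_mul_of_nonneg_right (hFa t ht) (Real.exp_pos _).le
  have integrable_error : IntegrableOn (fun t => (F t - S t) * w t) (Ioi 0) :=
    integrable_bound.mono' (by fun_prop) error_le
  have integral_error : (∫ t in Ioi 0, F t * w t) - ∫ t in Ioi 0, S t * w t
      = ∫ t in Ioi 0, (F t - S t) * w t := by
    rw [sub_eq_iff_eq_add, ← integral_add integrable_error integrable_S]
    simp only [← add_mul, sub_add_cancel]
  rw [← integral_sum_mul_exp_neg_mul_pow hr a N hx, integral_error,
    ← integral_pow_mul_exp_neg_mul_pow N hr hx, ← integral_const_mul]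
  exact norm_integral_le_of_norm_le integrable_bound error_le

/-- Beyond `T` the polynomial is at most a multiple of `t ^ N`, so cutting `F` off at `T` costs no
more than the error already present. -/
theorem exists_abs_indicator_Ioc_sub_le {T : ℝ} (hT : 0 < T)
    (hF : ∀ t ∈ Ioc 0 T, |F t - ∑ i ∈ Finset.range N, a i * t ^ i| ≤ C * t ^ N) :
    ∃ C', ∀ t > 0, |(Ioc 0 T).indicator F t - ∑ i ∈ Finset.range N, a i * t ^ i| ≤ C' * t ^ N := by
  set B := ∑ i ∈ Finset.range N, |a i| * (T ^ i / T ^ N)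
  refine ⟨max C B, fun t ht => ?_⟩
  by_cases htT : t ≤ T
  · rw [indicator_of_mem (mem_Ioc.2 ⟨ht, htT⟩)]
    exact (hF t ⟨ht, htT⟩).trans (by gcongr; exact le_max_left C B)
  · rw [indicator_of_notMem fun h => htT h.2, zero_sub, abs_neg]
    calc |∑ i ∈ Finset.range N, a i * t ^ i|
        ≤ ∑ i ∈ Finset.range N, |a i * t ^ i| := Finset.abs_sum_le_sum_abs _ _
      _ ≤ ∑ i ∈ Finset.range N, |a i| * (T ^ i / T ^ N) * t ^ N := by
          refine Finset.sum_le_sum fun i hi => ?_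
          have i_le : i ≤ N := (Finset.mem_range.1 hi).le
          have pow_le : t ^ i * T ^ N ≤ T ^ i * t ^ N := by
            rw [← pow_mul_pow_sub T i_le, ← pow_mul_pow_sub t i_le, mul_left_comm]
            gcongr
            exact (not_le.1 htT).le
          rw [abs_mul, abs_of_pos (pow_pos ht i), mul_assoc]
          refine mul_le_mul_of_nonneg_left ?_ (abs_nonneg _)
          rwa [div_mul_eq_mul_div, le_div_iff₀ (by positivity)]
      _ ≤ max C B * t ^ N := by
          rw [← Finset.sum_mul]
          gcongr
          exact le_max_right C B

end Watson

section Laplace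

variable {φ Y : ℝ → ℝ} {r : ℕ}

theorem intervalIntegral_exp_neg_mul_eq {T : ℝ} (hT : 0 < T) (hφ : ContinuousOn φ (Ici 0))
    (Y_zero : Y 0 = 0) (hY : ∀ t ∈ Icc 0 T, ContDiffAt ℝ 1 Y t)
    (φ_Y : ∀ t ∈ Ioc 0 T, 0 < Y t ∧ φ (Y t) = t ^ r) (x : ℝ) :
    ∫ y in 0..Y T, Real.exp (-(x * φ y))
      = ∫ t in Ioi 0, (Ioc 0 T).indicator (deriv Y) t * Real.exp (-(x * t ^ r)) := by
  have Y_nonneg : MapsTo Y (Icc 0 T) (Ici 0) := fun t ht => by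
    rcases ht.1.eq_or_lt with rfl | t_pos
    · exact Y_zero.ge
    · exact (φ_Y t ⟨t_pos, ht.2⟩).1.le
  have substitution := intervalIntegral.integral_comp_mul_deriv' (a := 0) (b := T) (f := Y)
    (f' := deriv Y) (g := fun y => Real.exp (-(x * φ y)))
    (fun t ht => ((hY t (uIcc_of_le hT.le ▸ ht)).differentiableAt one_ne_zero).hasDerivAt)
    (fun t ht => ((hY t (uIcc_of_le hT.le ▸ ht)).derivWithin
      (m := 0) (by simp)).continuousAt.continuousWithinAt)
    ((hφ.const_smul x).neg.rexp.mono (uIcc_of_le hT.le ▸ Y_nonneg.image_subset))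
  rw [Y_zero] at substitution
  rw [← substitution, intervalIntegral.integral_of_le hT.le]
  have indicator_mul_eq :
      (fun t => (Ioc 0 T).indicator (deriv Y) t * Real.exp (-(x * t ^ r))) =
        (Ioc 0 T).indicator fun t => deriv Y t * Real.exp (-(x * t ^ r)) := by
    funext t
    exact (indicator_mul_left _ _ fun t => Real.exp (-(x * t ^ r))).symm
  rw [indicator_mul_eq, setIntegral_indicator measurableSet_Ioc,
    inter_eq_right.2 Ioc_subset_Ioi_self]
  refine setIntegral_congr_fun measurableSet_Ioc fun t ht => ?_
  simp only [Function.comp_apply, (φ_Y t ht).2, mul_comm]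

theorem isBigO_intervalIntegral_exp_neg_mul_sub {T C : ℝ} {a : ℕ → ℝ} {N : ℕ} (hr : 0 < r)
    (hT : 0 < T) (hφ : ContinuousOn φ (Ici 0)) (Y_zero : Y 0 = 0)
    (hY : ∀ t ∈ Icc 0 T, ContDiffAt ℝ 1 Y t) (φ_Y : ∀ t ∈ Ioc 0 T, 0 < Y t ∧ φ (Y t) = t ^ r)
    (deriv_Y : ∀ t ∈ Ioc 0 T, |deriv Y t - ∑ i ∈ Finset.range N, a i * t ^ i| ≤ C * t ^ N) :
    (fun x => (∫ y in 0..Y T, Real.exp (-(x * φ y)))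
        - 1 / r * ∑ i ∈ Finset.range N,
            a i * Real.Gamma ((i + 1) / r) * x ^ (-((i + 1) / r : ℝ)))
      =O[atTop] fun x : ℝ => x ^ (-((N + 1) / r : ℝ)) := by
  obtain ⟨C', hC'⟩ := exists_abs_indicator_Ioc_sub_le hT deriv_Y
  refine .of_bound (C' * (1 / r * Real.Gamma ((N + 1) / r))) ?_
  filter_upwards [eventually_gt_atTop 0] with x hx
  rw [intervalIntegral_exp_neg_mul_eq hT hφ Y_zero hY φ_Y, Real.norm_eq_abs,
    Real.norm_of_nonneg (by positivity), mul_assoc, mul_assoc]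
  exact abs_integral_mul_exp_neg_mul_pow_sub_le hr
    ((measurable_deriv Y).indicator measurableSet_Ioc).aestronglyMeasurable hC' hx

theorem isBigO_integral_exp_neg_mul_sub (hr : 0 < r) (hφ : ContinuousOn φ (Ici 0))
    (φ_mono : MonotoneOn φ (Ici 0)) (hint : IntegrableOn (fun y => Real.exp (-φ y)) (Ioi 0))
    (hY : ContDiffAt ℝ 1 Y 0) (Y_zero : Y 0 = 0)
    (φ_Y : ∀ᶠ t in 𝓝[>] 0, 0 < Y t ∧ φ (Y t) = t ^ r) {a : ℕ → ℝ} {N : ℕ}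
    (deriv_Y : (fun t => deriv Y t - ∑ i ∈ Finset.range N, a i * t ^ i)
      =O[𝓝[>] 0] fun t => t ^ N) :
    (fun x => (∫ y in Ioi 0, Real.exp (-(x * φ y)))
        - 1 / r * ∑ i ∈ Finset.range N,
            a i * Real.Gamma ((i + 1) / r) * x ^ (-((i + 1) / r : ℝ)))
      =O[atTop] fun x : ℝ => x ^ (-((N + 1) / r : ℝ)) := by
  obtain ⟨C, hC⟩ := deriv_Y.bound
  obtain ⟨T, T_pos : 0 < T, hT⟩ := mem_nhdsGT_iff_exists_Ioc_subset.1
    (φ_Y.and (hC.and ((hY.eventually (by simp)).filter_mono nhdsWithin_le_nhds)))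
  have hY_T : ∀ t ∈ Icc 0 T, ContDiffAt ℝ 1 Y t := fun t ht => by
    rcases ht.1.eq_or_lt with rfl | t_pos
    · exact hY
    · exact (hT ⟨t_pos, ht.2⟩).2.2
  obtain ⟨Y_T_pos, φ_Y_T⟩ := (hT (right_mem_Ioc.2 T_pos)).1
  have φ_ge : ∀ᵐ y ∂volume.restrict (Ioi (Y T)), T ^ r ≤ φ y := by
    filter_upwards [ae_restrict_mem measurableSet_Ioi] with y (hy : Y T < y)
    exact φ_Y_T ▸ φ_mono Y_T_pos.le (Y_T_pos.trans hy).le hy.le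
  have hint_tail : IntegrableOn (fun y => Real.exp (-φ y)) (Ioi (Y T)) :=
    hint.mono_set (Ioi_subset_Ioi Y_T_pos.le)
  have head_isBigO := isBigO_intervalIntegral_exp_neg_mul_sub hr T_pos hφ Y_zero hY_T
    (fun t ht => (hT ht).1) fun t ht => by simpa [abs_of_pos ht.1] using (hT ht).2.1
  have tail_isBigO := isBigO_integral_exp_neg_mul (by positivity) φ_ge hint_tail
    (-((N + 1) / r : ℝ))
  refine (head_isBigO.add tail_isBigO).congr' ?_ .rfl
  filter_upwards [eventually_ge_atTop 1] with x hx
  have integrable_head : IntervalIntegrable (fun y => Real.exp (-(x * φ y))) volume 0 (Y T) :=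
    ((hφ.const_smul x).neg.rexp.mono
      (uIcc_of_le Y_T_pos.le ▸ Icc_subset_Ici_self)).intervalIntegrable
  have integrable_tail := integrable_exp_neg_mul
    (φ_ge.mono fun y hy => (by positivity : 0 ≤ T ^ r).trans hy) hint_tail hx
  rw [← intervalIntegral.integral_interval_add_Ioi' integrable_head integrable_tail]
  ring

end Laplace

section Expansion

variable {r : ℕ}

theorem isBigO_sub_sum_coeff_mul_pow {F : ℝ → ℝ} {p : FormalMultilinearSeries ℝ ℝ ℝ}
    (hp : HasFPowerSeriesAt F p 0) (N : ℕ) :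
    (fun t => F t - ∑ i ∈ Finset.range N, p.coeff i * t ^ i) =O[𝓝 0] fun t => t ^ N := by
  refine isBigO_norm_right.1 ?_
  simpa only [zero_add, FormalMultilinearSeries.partialSum,
    FormalMultilinearSeries.apply_eq_pow_smul_coeff, smul_eq_mul, mul_comm, norm_pow] using
    hp.isBigO_sub_partialSum_pow N

theorem exists_hasSum_g_and_isBigO_integral_exp_neg_mul_phase (hr : 0 < r) :
    ∃ a : ℕ → ℝ, (∀ᶠ t in 𝓝[>] 0, HasSum (fun i => a i * t ^ i) (g r t)) ∧
      ∀ N : ℕ, (fun x => (∫ y in Ioi 0, Real.exp (-(x * phase r y)))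
          - 1 / r * ∑ i ∈ Finset.range N,
              a i * Real.Gamma ((i + 1) / r) * x ^ (-((i + 1) / r : ℝ)))
        =O[atTop] fun x : ℝ => x ^ (-((N + 1) / r : ℝ)) := by
  obtain ⟨Y, hY, Y_zero, Y_inverse⟩ := exists_analyticAt_inverse hr
  obtain ⟨p, hp⟩ := hY.deriv
  refine ⟨p.coeff, ?_, fun N => ?_⟩
  · filter_upwards [Y_inverse, (hasFPowerSeriesAt_iff.1 hp).filter_mono nhdsWithin_le_nhds]
      with t ⟨_, _, deriv_Y⟩ hasSum_deriv_Y
    simpa only [zero_add, deriv_Y, smul_eq_mul, mul_comm] using hasSum_deriv_Y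
  · exact isBigO_integral_exp_neg_mul_sub hr (continuousOn_phase hr)
      (strictMonoOn_phase hr).monotoneOn (integrableOn_exp_neg_phase hr) hY.contDiffAt Y_zero
      (Y_inverse.mono fun _ ht => ⟨ht.1, ht.2.1⟩)
      ((isBigO_sub_sum_coeff_mul_pow hp N).mono nhdsWithin_le_nhds)

theorem IsDrawingWithReplacement.toReal_expectedRepetitionTime_div_eq_integral {Ω : Type*}
    [MeasurableSpace Ω] {P : Measure Ω} {n : ℕ} {D : ℕ → Ω → Fin n} {h : Fin n → Fin n}
    (hD : IsDrawingWithReplacement P D) (hconf : ∀ i, configuration h i = 1) (hr : 0 < r) :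
    (expectedRepetitionTime P h D r).toReal / n
      = ∫ y in Ioi 0, Real.exp (-(n / r.factorial * phase r y)) := by
  have hn : (0 : ℝ) < n := Nat.cast_pos.2 hD.pos
  have integrand_eq : EqOn
      (fun y => (∏ i, q r (configuration h i * y)) * Real.exp (-(n * y)))
      (fun y => Real.exp (-(n / r.factorial * phase r y))) (Ioi 0) := fun y hy => by
    simp [hconf, exp_neg_div_factorial_mul_phase hr n (le_of_lt hy)]
  rw [hD.expectedRepetitionTime_eq_integral h hr,
    setIntegral_congr_fun measurableSet_Ioi integrand_eq, ENNReal.toReal_ofReal (by positivity),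
    mul_div_cancel_left₀ _ hn.ne']

theorem isBigO_div_rpow_neg {ι : Type*} {l : Filter ι} {u : ι → ℝ} (hu : ∀ n, 0 ≤ u n) {c : ℝ}
    (hc : 0 ≤ c) (N : ℕ) :
    (fun n => (u n / c) ^ (-((N + 1) / r : ℝ)))
      =O[l] fun n => (u n ^ (-1 / (r : ℝ))) ^ (N + 1) := by
  have rescale (n : ι) : (u n / c) ^ (-((N + 1) / r : ℝ))
      = (c ^ (-((N + 1) / r : ℝ)))⁻¹ * (u n ^ (-1 / (r : ℝ))) ^ (N + 1) := by
    rw [Real.div_rpow (hu n) hc, ← Real.rpow_mul_natCast (hu n), div_eq_inv_mul]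
    push_cast
    ring_nf
  simp only [rescale]
  exact (isBigO_refl _ _).const_mul_left _

end Expansion

end Birthday

/-- Classical case: `n` balls, `n` colours, one ball of each colour. The coefficients `a` depend only
on `r`: they are the coefficients of the power series of `g_r` at `0`. The last line says that the
series is an asymptotic expansion of `E(R_r)/n` in powers of `n^{-1/r}`. -/
theorem mainTheorem8 (r : ℕ) (hr : 2 ≤ r) :
    ∃ a : ℕ → ℝ,
      (∃ ε > 0, ∀ t ∈ Set.Ioo (0 : ℝ) ε, HasSum (fun i => a i * t ^ i) (Birthday.g r t)) ∧
      ∀ (Ω : ℕ+ → Type*) [∀ n, MeasurableSpace (Ω n)] (P : ∀ n, Measure (Ω n))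
        [∀ n, IsProbabilityMeasure (P n)]
        (h : ∀ n : ℕ+, Fin n → Fin n) (D : ∀ n : ℕ+, ℕ → Ω n → Fin n),
        (∀ n i, Birthday.configuration (h n) i = 1) →
        (∀ n, Birthday.IsDrawingWithReplacement (P n) (D n)) →
        (∀ n, Birthday.expectedRepetitionTime (P n) (h n) (D n) r ≠ ⊤) ∧
        ∀ N : ℕ,
          (fun n : ℕ+ =>
            (Birthday.expectedRepetitionTime (P n) (h n) (D n) r).toReal / ((n : ℕ) : ℝ)
              - 1 / (r : ℝ) * ∑ i ∈ Finset.range N,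
                  a i * Real.Gamma (((i : ℝ) + 1) / (r : ℝ))
                    * ((r.factorial : ℝ) / ((n : ℕ) : ℝ)) ^ (((i : ℝ) + 1) / (r : ℝ)))
          =O[atTop] fun n : ℕ+ => (((n : ℕ) : ℝ) ^ (-1 / (r : ℝ))) ^ (N + 1) := by
  have hr_pos : 0 < r := by omega
  obtain ⟨a, hasSum_g, laplace⟩ :=
    Birthday.exists_hasSum_g_and_isBigO_integral_exp_neg_mul_phase hr_pos
  obtain ⟨ε, ε_pos, hε⟩ := mem_nhdsGT_iff_exists_Ioo_subset.1 hasSum_g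
  refine ⟨a, ⟨ε, ε_pos, fun t ht => hε ht⟩, fun Ω _ P _ h D hconf hD => ⟨fun n => ?_, fun N => ?_⟩⟩
  · rw [(hD n).expectedRepetitionTime_eq_integral (h n) hr_pos]
    exact ENNReal.ofReal_ne_top
  · have scale_tendsto : Tendsto (fun n : ℕ+ => ((n : ℕ) : ℝ) / r.factorial) atTop atTop :=
      (tendsto_natCast_atTop_atTop.comp tendsto_PNat_val_atTop_atTop).atTop_div_const
        (by positivity)
    refine (((laplace N).comp_tendsto scale_tendsto).congr_left fun n => ?_).trans
      (Birthday.isBigO_div_rpow_neg (fun n => Nat.cast_nonneg _) (Nat.cast_nonneg _) N)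
    rw [(hD n).toReal_expectedRepetitionTime_div_eq_integral (hconf n) hr_pos]
    simp only [Function.comp_apply, Real.rpow_neg_eq_inv_rpow, inv_div]
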